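/- Conventions. A continuous surjection $f\colon X\to Y$ of topological spaces is semi-open if $f[U]$ has non-empty interior in $Y$ for every non-empty open $U\subseteq X$. For a topological group $T$, a compact flow $T\curvearrowright X$ is a jointly continuous action of $T$ on a compact Hausdorff space $X$; it is minimal if $\overline{Tx}=X$ for all $x\in X$. An extension $\phi\colon\mathscr{X}\to\mathscr{Y}$ of compact flows (with the same group $T$) is a continuous surjection $\phi\colon X\to Y$ with $\phi(tx)=t\phi(x)$ for all $t\in T$, $x\in X$. $2^X$ is the space of non-empty closed subsets of $X$ with the Vietoris topology, $T$ acts on it by $tK=\{tx : x\in K\}$ (the hyperflow $2^{\mathscr{X}}$), and $2^\phi\colon 2^X\to 2^Y$ is $K\mapsto\phi[K]$. $\mathfrak{M}(X)$ is the space of regular Borel probability measures on $X$ with the weak-$*$ topology (if $X$ is compact metric, every Borel probability measure on $X$ is regular), $T$ acts on it by pushing measures forward along $x\mapsto tx$, and $\phi_*\colon\mathfrak{M}(X)\to\mathfrak{M}(Y)$ is $\mu\mapsto\mu\circ\phi^{-1}$. Corollary 7. Let $T$ be a topological group and let $\phi\colon\mathscr{X}\to\mathscr{Y}$ be an extension of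 compact minimal flows with phase group $T$ and phase spaces $X$, $Y$. Then: (1) $2^\phi\colon 2^{\mathscr{X}}\to 2^{\mathscr{Y}}$ and $2^{2^\phi}\colon 2^{2^{\mathscr{X}}}\to 2^{2^{\mathscr{Y}}}$ are both semi-open extensions of compact flows. (2) If $X$ and $Y$ are both compact metric spaces, then $\phi_*\colon\mathfrak{M}(X)\to\mathfrak{M}(Y)$ and $(\phi_*)_*\colon\mathfrak{M}(\mathfrak{M}(X))\to\mathfrak{M}(\mathfrak{M}(Y))$, with the induced actions of $T$, are both semi-open extensions of compact flows. -/

import Mathlib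

open TopologicalSpace MeasureTheory

universe u v w

/-- `f` is semi-open: the image of every nonempty open set has nonempty interior. -/
def IsSemiOpen {X : Type v} {Y : Type w} [TopologicalSpace X] [TopologicalSpace Y]
    (f : X → Y) : Prop :=
  ∀ U : Set X, IsOpen U → U.Nonempty → (interior (f '' U)).Nonempty

/-- `T ↷ X` is a compact flow: the phase space is compact Hausdorff and the action
`T × X → X` is jointly continuous. (The laws of the action are part of `MulAction T X`.) -/
structure IsCompactFlow (T : Type u) (X : Type v) [TopologicalSpace T] [Group T]
    [TopologicalSpace X] [MulAction T X] : Prop where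
  compactSpace : CompactSpace X
  t2Space : T2Space X
  continuousSMul : ContinuousSMul T X

/-- The continuous map `φ` is an extension of compact flows: both sides are compact flows and
`φ` is onto and equivariant. -/
structure IsFlowExtension (T : Type u) {X : Type v} {Y : Type w} [TopologicalSpace T] [Group T]
    [TopologicalSpace X] [MulAction T X] [TopologicalSpace Y] [MulAction T Y]
    (φ : C(X, Y)) : Prop where
  source : IsCompactFlow T X
  target : IsCompactFlow T Y
  surjective : Function.Surjective φ
  map_smul : ∀ (t : T) (x : X), φ (t • x) = t • φ x

/-- A semi-open extension of compact flows. -/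
structure IsSemiOpenFlowExtension (T : Type u) {X : Type v} {Y : Type w} [TopologicalSpace T]
    [Group T] [TopologicalSpace X] [MulAction T X] [TopologicalSpace Y] [MulAction T Y]
    (φ : C(X, Y)) : Prop where
  isFlowExtension : IsFlowExtension T φ
  isSemiOpen : IsSemiOpen φ

section Hyperspace

/-- The hyperspace `2^X` of nonempty closed subsets of `X`, with the Vietoris topology (an instance
in Mathlib). For compact Hausdorff `X`, closed and compact subsets are the same. -/
abbrev Hyperspace (X : Type v) [TopologicalSpace X] : Type v := NonemptyCompacts X

/-- The induced map `2^φ : 2^X → 2^Y`, `K ↦ φ[K]`. -/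
def hyperMap {X : Type v} {Y : Type w} [TopologicalSpace X] [TopologicalSpace Y]
    (φ : C(X, Y)) : C(Hyperspace X, Hyperspace Y) where
  toFun K := NonemptyCompacts.map φ φ.continuous K
  continuous_toFun := φ.continuous.nonemptyCompacts_map

/-- The induced action on the hyperspace: `t • K = {t • x | x ∈ K}`. -/
instance hyperAction {T : Type u} {X : Type v} [Group T] [TopologicalSpace X] [MulAction T X]
    [ContinuousConstSMul T X] : MulAction T (Hyperspace X) where
  smul t K := NonemptyCompacts.map (fun x : X => t • x) (continuous_const_smul t) K
  one_smul K := by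
    apply SetLike.coe_injective
    change (fun x : X => (1 : T) • x) '' (K : Set X) = K
    simp
  mul_smul s t K := by
    apply SetLike.coe_injective
    change (fun x : X => (s * t) • x) '' (K : Set X) =
      (fun x : X => s • x) '' ((fun x : X => t • x) '' (K : Set X))
    rw [Set.image_image]
    simp only [mul_smul]

instance hyperAction_continuousConstSMul {T : Type u} {X : Type v} [Group T] [TopologicalSpace X]
    [MulAction T X] [ContinuousConstSMul T X] : ContinuousConstSMul T (Hyperspace X) where
  continuous_const_smul t :=
    (continuous_const_smul (T := X) t).nonemptyCompacts_map

end Hyperspace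

section ProbabilitySpace

/-- The space `𝔐(X)` of Borel probability measures on `X`. On a compact metrizable space every
Borel probability measure is regular, so for such `X` this is the space of regular Borel
probability measures. It is a `def`, so that `𝔐(𝔐(X))` refers to the Borel σ-algebra of the
weak-* topology of `𝔐(X)`. -/
def ProbSpace (X : Type v) [TopologicalSpace X] : Type v :=
  @ProbabilityMeasure X (borel X)

/-- The weak-* topology on `𝔐(X)`: the coarsest one for which integration against each bounded
continuous function is continuous. -/
noncomputable instance ProbSpace.instTopologicalSpace (X : Type v) [TopologicalSpace X] :
    TopologicalSpace (ProbSpace X) :=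
  @ProbabilityMeasure.instTopologicalSpace X (borel X) _
    (@BorelSpace.opensMeasurable X _ (borel X) (@BorelSpace.mk X _ (borel X) rfl))

/-- The induced map `φ_* : 𝔐(X) → 𝔐(Y)`, `μ ↦ μ ∘ φ⁻¹`. -/
noncomputable def probMap {X : Type v} {Y : Type w} [TopologicalSpace X] [TopologicalSpace Y]
    (φ : C(X, Y)) : C(ProbSpace X, ProbSpace Y) :=
  letI : MeasurableSpace X := borel X
  haveI : BorelSpace X := ⟨rfl⟩
  letI : MeasurableSpace Y := borel Y
  haveI : BorelSpace Y := ⟨rfl⟩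
  { toFun := fun μ : ProbabilityMeasure X => μ.map φ.continuous.measurable.aemeasurable
    continuous_toFun := ProbabilityMeasure.continuous_map φ.continuous }

/-- The induced action on `𝔐(X)`: `t • μ` is the image of `μ` under `x ↦ t • x`. -/
noncomputable instance probAction {T : Type u} {X : Type v} [Group T] [TopologicalSpace X]
    [MulAction T X] [ContinuousConstSMul T X] : MulAction T (ProbSpace X) where
  smul t μ := probMap ⟨fun x : X => t • x, continuous_const_smul t⟩ μ
  one_smul μ := by
    let _ : MeasurableSpace X := borel X
    have _ : BorelSpace X := ⟨rfl⟩
    apply Subtype.ext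
    change Measure.map (fun x : X => (1 : T) • x) μ.1 = μ.1
    simp
  mul_smul s t μ := by
    let _ : MeasurableSpace X := borel X
    have _ : BorelSpace X := ⟨rfl⟩
    apply Subtype.ext
    change Measure.map (fun x : X => (s * t) • x) μ.1 =
      Measure.map (fun x : X => s • x) (Measure.map (fun x : X => t • x) μ.1)
    rw [Measure.map_map (continuous_const_smul s).measurable (continuous_const_smul t).measurable]
    simp only [mul_smul, Function.comp_def]

instance probAction_continuousConstSMul {T : Type u} {X : Type v} [Group T] [TopologicalSpace X]
    [MulAction T X] [ContinuousConstSMul T X] : ContinuousConstSMul T (ProbSpace X) where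
  continuous_const_smul t :=
    (probMap (⟨fun x : X => t • x, continuous_const_smul t⟩ : C(X, X))).continuous

end ProbabilitySpace

open Topology
open scoped Pointwise

/-! Minimality enters only through semi-openness of `φ`: finitely many translates of a closed set
`V` with interior cover `X`, so finitely many translates of the closed set `φ '' V` cover `Y`. By
Baire one of them has interior, and translations are homeomorphisms. Semi-openness then passes to
hyperspaces (`IsSemiOpen.hyperMap`) and, in the metrizable case, to measures
(`IsSemiOpen.map_probabilityMeasure`). As the flow structure and surjectivity pass too, each
construction can be iterated.

For measures, a given open set contains a finitely supported `μ`. Move each atom `x` to a point `y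
x` interior to the image of a small ball about `x`. Any `ν` near the resulting measure lifts: its
mass near `y x` is shared among the atoms sent there and pulled back into their balls by measurable
sections. The rest is lifted arbitrarily. -/

theorem IsFlowExtension.isSemiOpen {T : Type u} {X : Type v} {Y : Type w}
    [TopologicalSpace T] [Group T] [TopologicalSpace X] [MulAction T X]
    [MulAction.IsMinimal T X] [TopologicalSpace Y] [MulAction T Y]
    {φ : C(X, Y)} (hφ : IsFlowExtension T φ) : IsSemiOpen φ := by
  have := hφ.source.compactSpace
  have := hφ.source.t2Space
  have := hφ.source.continuousSMul
  have := hφ.target.compactSpace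
  have := hφ.target.t2Space
  have := hφ.target.continuousSMul
  rintro U hU ⟨x, hx⟩
  obtain ⟨V, hV, hVc, hVU⟩ := exists_mem_nhds_isClosed_subset (hU.mem_nhds hx)
  obtain ⟨I, hI⟩ := isCompact_univ.exists_finite_cover_smul T isOpen_interior
    ⟨x, mem_interior_iff_mem_nhds.2 hV⟩
  have hclosed : ∀ t : I, IsClosed ((t : T) • (φ '' V)) := fun t =>
    ((hVc.isCompact.image φ.continuous).isClosed).smul _
  have : Nonempty Y := ⟨φ x⟩
  obtain ⟨t, ht⟩ := nonempty_interior_of_iUnion_of_closed hclosed (by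
    refine Set.eq_univ_of_forall fun y => ?_
    obtain ⟨z, rfl⟩ := hφ.surjective y
    obtain ⟨t, htI, w, hw, rfl⟩ := Set.mem_iUnion₂.1 (hI (Set.mem_univ z))
    exact Set.mem_iUnion.2
      ⟨⟨t, htI⟩, φ w, Set.mem_image_of_mem φ (interior_subset hw), (hφ.map_smul t w).symm⟩)
  rw [interior_smul, Set.smul_set_nonempty] at ht
  exact ht.mono (interior_mono (Set.image_mono hVU))

/-! ### Hyperspaces. -/

theorem IsSemiOpen.hyperMap {X : Type v} {Y : Type w} [TopologicalSpace X] [CompactSpace X]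
    [T2Space X] [TopologicalSpace Y] [T2Space Y] {φ : C(X, Y)} (hφ : IsSemiOpen φ) :
    IsSemiOpen (hyperMap φ) := by
  rintro 𝒰 h𝒰 ⟨K₀, hK₀⟩
  obtain ⟨_, ⟨u, ⟨hfin, hne, hopen⟩, rfl⟩, ⟨hK₀u, hK₀n⟩, hsub⟩ :=
    NonemptyCompacts.isTopologicalBasis.exists_subset_of_mem_open hK₀ h𝒰
  have key : ∀ U ∈ u, ∃ V : Set X, IsClosed V ∧ V ⊆ U ∧ (interior (φ '' V)).Nonempty := by
    intro U hU
    obtain ⟨x, -, hxU⟩ := hK₀n U hU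
    obtain ⟨V, hV, hxV, hVU⟩ := exists_mem_nhds_isClosed_subset ((hopen U hU).mem_nhds hxU)
    refine ⟨V, hxV, hVU, ?_⟩
    obtain ⟨y, hy⟩ := hφ (interior V) isOpen_interior ⟨x, mem_interior_iff_mem_nhds.2 hV⟩
    exact ⟨y, interior_mono (Set.image_mono interior_subset) hy⟩
  choose! V hVc hVU hVn using key
  have : Nonempty Y := ⟨φ K₀.nonempty.some⟩
  choose! y hy using hVn
  let 𝒲 : Set (Hyperspace Y) :=
    {L | (L : Set Y) ⊆ ⋃ U ∈ u, interior (φ '' V U)} ∩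
      ⋂ U ∈ u, {L | ((L : Set Y) ∩ interior (φ '' V U)).Nonempty}
  have h𝒲 : IsOpen 𝒲 :=
    (NonemptyCompacts.isOpen_subsets_of_isOpen
      (isOpen_biUnion fun U _ => isOpen_interior)).inter
      (hfin.isOpen_biInter fun U _ => NonemptyCompacts.isOpen_inter_nonempty_of_isOpen
        isOpen_interior)
  refine ⟨⟨⟨y '' u, (hfin.image y).isCompact⟩, hne.image y⟩, mem_interior.2 ⟨𝒲, ?_, h𝒲, ?_⟩⟩
  · rintro L ⟨hL₁, hL₂⟩
    rw [Set.mem_iInter₂] at hL₂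
    -- The largest lift of `L` inside the union of the `V U`. Closedness of the `V U` makes it
    -- compact, and it maps onto `L` because the sets `φ '' V U` cover `L`.
    let K : Set X := φ ⁻¹' L ∩ ⋃ U ∈ u, V U
    have hKc : IsCompact K :=
      ((L.isCompact.isClosed.preimage φ.continuous).inter
        (hfin.isClosed_biUnion fun U hU => hVc U hU)).isCompact
    have hmeet : ∀ U ∈ u, (K ∩ V U).Nonempty := by
      intro U hU
      obtain ⟨z, hzL, hz⟩ := hL₂ U hU
      obtain ⟨x, hxV, rfl⟩ := interior_subset hz
      exact ⟨x, ⟨hzL, Set.mem_biUnion hU hxV⟩, hxV⟩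
    have hKn : K.Nonempty := by
      obtain ⟨U, hU⟩ := hne
      exact (hmeet U hU).mono Set.inter_subset_left
    refine ⟨⟨⟨K, hKc⟩, hKn⟩, hsub ⟨?_, fun U hU => ?_⟩, ?_⟩
    · rintro x ⟨-, hx⟩
      obtain ⟨U, hU, hxU⟩ := Set.mem_iUnion₂.1 hx
      exact ⟨U, hU, hVU U hU hxU⟩
    · exact (hmeet U hU).mono (Set.inter_subset_inter_right _ (hVU U hU))
    · apply SetLike.coe_injective
      change φ '' K = L
      refine Set.Subset.antisymm ?_ fun z hz => ?_
      · rintro _ ⟨x, hx, rfl⟩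
        exact hx.1
      · obtain ⟨U, hU, hzU⟩ := Set.mem_iUnion₂.1 (hL₁ hz)
        obtain ⟨x, hxV, rfl⟩ := interior_subset hzU
        exact ⟨x, ⟨hz, Set.mem_biUnion hU hxV⟩, rfl⟩
  · refine ⟨?_, Set.mem_iInter₂.2 fun U hU => ⟨y U, ⟨U, hU, rfl⟩, hy U hU⟩⟩
    rintro _ ⟨U, hU, rfl⟩
    exact Set.mem_biUnion hU (hy U hU)

theorem IsCompactFlow.hyperspace {T : Type u} {X : Type v} [TopologicalSpace T] [Group T]
    [TopologicalSpace X] [MulAction T X] [ContinuousConstSMul T X] (h : IsCompactFlow T X) :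
    IsCompactFlow T (Hyperspace X) := by
  obtain ⟨_, _, _⟩ := h
  refine ⟨inferInstance, inferInstance, ⟨?_⟩⟩
  exact Continuous.nonemptyCompacts_map' (f := fun p : T × Hyperspace X => p.2)
    (g := fun p x => p.1 • x) continuous_snd (by fun_prop)

theorem IsSemiOpenFlowExtension.hyperMap {T : Type u} {X : Type v} {Y : Type w}
    [TopologicalSpace T] [Group T] [TopologicalSpace X] [MulAction T X] [ContinuousConstSMul T X]
    [TopologicalSpace Y] [MulAction T Y] [ContinuousConstSMul T Y] {φ : C(X, Y)}
    (h : IsSemiOpenFlowExtension T φ) : IsSemiOpenFlowExtension T (hyperMap φ) := by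
  have := h.isFlowExtension.source.compactSpace
  have := h.isFlowExtension.source.t2Space
  have := h.isFlowExtension.target.t2Space
  refine ⟨⟨h.isFlowExtension.source.hyperspace, h.isFlowExtension.target.hyperspace, fun L => ?_,
    fun t K => ?_⟩, h.isSemiOpen.hyperMap⟩
  · refine ⟨⟨⟨φ ⁻¹' L, (L.isCompact.isClosed.preimage φ.continuous).isCompact⟩,
      L.nonempty.preimage h.isFlowExtension.surjective⟩, SetLike.coe_injective ?_⟩
    exact Set.image_preimage_eq _ h.isFlowExtension.surjective
  · apply SetLike.coe_injective
    change φ '' ((fun x => t • x) '' (K : Set X)) = (fun y => t • y) '' (φ '' (K : Set X))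
    simp only [Set.image_image, h.isFlowExtension.map_smul]

/-! ### Measurable sections. -/

/-- Parametrise `X` by the Cantor set and take the least parameter in each fibre. Minima exist by
compactness, and sublevel sets of the minimum are, over `φ '' K`, continuous images of compact sets,
hence closed. -/
theorem exists_measurable_section_of_isClosed {X : Type v} {Y : Type w} [TopologicalSpace X]
    [CompactSpace X] [MetrizableSpace X] [MeasurableSpace X] [BorelSpace X] [Nonempty X]
    [TopologicalSpace Y] [T2Space Y] [MeasurableSpace Y] [BorelSpace Y] {φ : X → Y}
    (hφ : Continuous φ) {K : Set X} (hK : IsClosed K) :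
    ∃ s : Y → X, Measurable s ∧ ∀ y ∈ φ '' K, s y ∈ K ∧ φ (s y) = y := by
  let _ := metrizableSpaceMetric X
  obtain ⟨c₀, hc₀, hc₀s⟩ := exists_nat_bool_continuous_surjective_of_compact X
  let c : cantorSet → X := c₀ ∘ cantorSetHomeomorphNatToBool
  have hc : Continuous c := hc₀.comp cantorSetHomeomorphNatToBool.continuous
  have hcs : Function.Surjective c := hc₀s.comp cantorSetHomeomorphNatToBool.surjective
  have : CompactSpace cantorSet := isCompact_iff_compactSpace.1 isCompact_cantorSet
  let E : Y → Set ℝ := fun y => Subtype.val '' (c ⁻¹' (K ∩ φ ⁻¹' {y}))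
  have hE : ∀ y, IsCompact (E y) := fun y =>
    (((hK.inter (isClosed_singleton.preimage hφ)).preimage hc).isCompact).image
      continuous_subtype_val
  have hEn : ∀ y ∈ φ '' K, (E y).Nonempty := by
    rintro _ ⟨x, hx, rfl⟩
    obtain ⟨r, rfl⟩ := hcs x
    exact ⟨r, r, ⟨hx, rfl⟩, rfl⟩
  have hE0 : ∀ y ∉ φ '' K, E y = ∅ := by
    intro y hy
    refine Set.eq_empty_of_forall_notMem ?_
    rintro _ ⟨r, ⟨hrK, hr⟩, rfl⟩
    exact hy ⟨c r, hrK, hr⟩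
  have hinf : ∀ y ∈ φ '' K, sInf (E y) ∈ E y := fun y hy => (hE y).sInf_mem (hEn y hy)
  have hmem : ∀ y, sInf (E y) ∈ cantorSet := by
    intro y
    by_cases hy : y ∈ φ '' K
    · obtain ⟨r, -, hr⟩ := hinf y hy
      exact hr ▸ r.2
    -- Off `φ '' K` the infimum of the empty set is `0`, a point of the Cantor set. The set `{_y | 0
    -- ≤ a}` below accounts for this value.
    · rw [hE0 y hy, Real.sInf_empty]
      exact zero_mem_cantorSet
  have hcl : IsClosed (φ '' K) := (hK.isCompact.image hφ).isClosed
  have hmeas : Measurable fun y => sInf (E y) := by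
    refine measurable_of_Iic fun a => ?_
    let A : Set Y := (fun r => φ (c r)) '' (c ⁻¹' K ∩ Subtype.val ⁻¹' Set.Iic a)
    have hA : IsClosed A :=
      (((hK.preimage hc).inter (isClosed_Iic.preimage continuous_subtype_val)).isCompact.image
        (hφ.comp hc)).isClosed
    have : (fun y => sInf (E y)) ⁻¹' Set.Iic a = A ∪ ((φ '' K)ᶜ ∩ {_y | 0 ≤ a}) := by
      ext y
      by_cases hy : y ∈ φ '' K
      · simp only [Set.mem_preimage, Set.mem_Iic, Set.mem_union, Set.mem_inter_iff,
          Set.mem_compl_iff, hy, not_true_eq_false, false_and, or_false]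
        constructor
        · intro h
          obtain ⟨r, ⟨hrK, hr⟩, hr'⟩ := hinf y hy
          exact ⟨r, ⟨hrK, hr'.trans_le h⟩, hr⟩
        · rintro ⟨r, ⟨hrK, hra⟩, hr⟩
          exact (csInf_le (hE y).bddBelow ⟨r, ⟨hrK, hr⟩, rfl⟩).trans hra
      · have hyA : y ∉ A := by
          rintro ⟨r, ⟨hrK, -⟩, hr⟩
          exact hy ⟨c r, hrK, hr⟩
        simp [hE0 y hy, hyA, hy]
    rw [this]
    exact hA.measurableSet.union (hcl.measurableSet.compl.inter (MeasurableSet.const _))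
  refine ⟨fun y => c ⟨sInf (E y), hmem y⟩, hc.measurable.comp (hmeas.subtype_mk), fun y hy => ?_⟩
  obtain ⟨r, ⟨hrK, hr⟩, hr'⟩ := hinf y hy
  have : (⟨sInf (E y), hmem y⟩ : cantorSet) = r := Subtype.ext hr'.symm
  simp only [this]
  exact ⟨hrK, hr⟩

theorem exists_measurable_rightInverse_mapsTo {X : Type v} {Y : Type w} [TopologicalSpace X]
    [CompactSpace X] [MetrizableSpace X] [MeasurableSpace X] [BorelSpace X] [Nonempty X]
    [TopologicalSpace Y] [T2Space Y] [MeasurableSpace Y] [BorelSpace Y] {φ : X → Y}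
    (hφ : Continuous φ) (hs : Function.Surjective φ) {K : Set X} (hK : IsClosed K) :
    ∃ s : Y → X, Measurable s ∧ Function.RightInverse s φ ∧ Set.MapsTo s (φ '' K) K := by
  classical
  obtain ⟨s, hsm, hsK⟩ := exists_measurable_section_of_isClosed hφ hK
  obtain ⟨s', hsm', hsK'⟩ := exists_measurable_section_of_isClosed hφ (isClosed_univ (X := X))
  refine ⟨(φ '' K).piecewise s s', hsm.piecewise
    (hK.isCompact.image hφ).isClosed.measurableSet hsm', fun y => ?_, fun y hy => ?_⟩
  · by_cases hy : y ∈ φ '' K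
    · simpa [hy] using (hsK y hy).2
    · rw [Set.piecewise_eq_of_notMem _ _ _ hy]
      exact (hsK' y (by simpa using hs y)).2
  · rw [Set.piecewise_eq_of_mem _ _ _ hy]
    exact (hsK y hy).1

/-! ### Finitely supported measures and weak neighbourhoods. -/

section ProbabilityMeasure

open Filter

variable {X : Type v} [TopologicalSpace X] [MeasurableSpace X] [BorelSpace X]

/-- Push `μ₀` forward along simple functions converging pointwise to the identity; dominated
convergence gives weak convergence. Null points are discarded because the weights are later used as
divisors. -/
theorem exists_finset_measure_compl_eq_zero_mem [PseudoMetrizableSpace X] [SeparableSpace X]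
    [T1Space X]
    (μ₀ : ProbabilityMeasure X) {U : Set (ProbabilityMeasure X)} (hU : U ∈ 𝓝 μ₀) :
    ∃ μ ∈ U, ∃ F : Finset X, (μ : Measure X) (F : Set X)ᶜ = 0 ∧
      ∀ x ∈ F, (μ : Measure X) {x} ≠ 0 := by
  classical
  let _ := pseudoMetrizableSpacePseudoMetric X
  have : Nonempty X := nonempty_of_isProbabilityMeasure (μ₀ : Measure X)
  obtain ⟨x₀⟩ := this
  let Q : ℕ → SimpleFunc X X := SimpleFunc.approxOn id measurable_id Set.univ x₀ trivial
  have hQ : ∀ x, Tendsto (fun n => Q n x) atTop (𝓝 x) := fun x =>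
    SimpleFunc.tendsto_approxOn measurable_id (s := Set.univ) trivial (by simp)
  have hlim : Tendsto (fun n => μ₀.map (Q n).measurable.aemeasurable) atTop (𝓝 μ₀) := by
    rw [ProbabilityMeasure.tendsto_iff_forall_integral_tendsto]
    intro f
    have : ∀ n, ∫ x, f x ∂(μ₀.map (Q n).measurable.aemeasurable : Measure X) =
        ∫ x, f (Q n x) ∂(μ₀ : Measure X) := fun n =>
      integral_map (Q n).measurable.aemeasurable f.continuous.measurable.aestronglyMeasurable
    simp only [this]
    refine tendsto_integral_of_dominated_convergence (fun _ => ‖f‖)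
      (fun n => (f.continuous.measurable.comp (Q n).measurable).aestronglyMeasurable)
      (integrable_const _) (fun n => .of_forall fun x => f.norm_coe_le_norm _)
      (.of_forall fun x => (f.continuous.tendsto x).comp (hQ x))
  obtain ⟨n, hn⟩ := (hlim.eventually hU).exists
  set μ := μ₀.map (Q n).measurable.aemeasurable
  refine ⟨μ, hn, (Q n).range.filter fun x => (μ : Measure X) {x} ≠ 0, ?_, by simp⟩
  have hsub : ((((Q n).range.filter fun x => (μ : Measure X) {x} ≠ 0 : Finset X) : Set X)ᶜ) ⊆
      ((Q n).range : Set X)ᶜ ∪ ⋃ x ∈ (Q n).range.filter fun x => (μ : Measure X) {x} = 0, {x} := by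
    intro x hx
    by_cases h : x ∈ (Q n).range <;> by_cases h' : (μ : Measure X) {x} = 0 <;> simp_all
  refine measure_mono_null hsub (measure_union_null ?_ ?_)
  · change Measure.map (Q n) (μ₀ : Measure X) _ = 0
    rw [Measure.map_apply (Q n).measurable (Finset.measurableSet _).compl]
    convert measure_empty (μ := (μ₀ : Measure X))
    ext x
    simp
  · refine (measure_biUnion_null_iff (Finset.countable_toSet _)).2 ?_
    intro x hx
    simp_all

theorem measure_eq_sum_of_compl_eq_zero [T1Space X] {μ : Measure X} {F : Finset X}
    (hF : μ (F : Set X)ᶜ = 0) (G : Set X) [DecidablePred (· ∈ G)] :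
    μ G = ∑ x ∈ F with x ∈ G, μ {x} := by
  rw [sum_measure_singleton]
  refine le_antisymm ?_ (measure_mono (by intro x; simp))
  calc μ G ≤ μ (((F.filter (· ∈ G) : Finset X) : Set X) ∪ (F : Set X)ᶜ) :=
        measure_mono (by intro x hx; by_cases h : x ∈ F <;> simp [hx, h])
    _ ≤ _ := (measure_union_le _ _).trans (by rw [hF, add_zero])

/-- By the portmanteau theorem lower bounds on open sets suffice. For radii tending to `0`, the
balls about the finitely many atoms in an open `G` eventually lie in `G`, so failure for every `δ`
would give a sequence converging to `μ` outside `U`. -/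
theorem exists_forall_mem_of_measure_le_closedBall {X : Type v} [MetricSpace X]
    [MeasurableSpace X] [BorelSpace X] {μ : ProbabilityMeasure X} {F : Finset X}
    (hF : (μ : Measure X) (F : Set X)ᶜ = 0) {U : Set (ProbabilityMeasure X)} (hU : U ∈ 𝓝 μ) :
    ∃ δ : ℝ, 0 < δ ∧ ∀ (ν : ProbabilityMeasure X) (ρ : X → Measure X),
      ∑ x ∈ F, ρ x ≤ (ν : Measure X) →
      (∀ x ∈ F, (μ : Measure X) {x} ≤ ρ x (Metric.closedBall x δ) + ENNReal.ofReal δ) → ν ∈ U := by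
  classical
  by_contra! hcon
  choose ν ρ hρ hν hνU using fun n : ℕ => hcon (1 / ((n : ℝ) + 1)) Nat.one_div_pos_of_nat
  suffices Tendsto ν atTop (𝓝 μ) by
    obtain ⟨n, hn⟩ := (this.eventually hU).exists
    exact hνU n hn
  refine tendsto_of_forall_isOpen_le_liminf' fun G hG => ?_
  set F' := F.filter (· ∈ G)
  have hδ : Tendsto (fun n : ℕ => (1 : ℝ) / ((n : ℝ) + 1)) atTop (𝓝 0) :=
    tendsto_one_div_add_atTop_nhds_zero_nat
  have hball : ∀ᶠ n : ℕ in atTop, ∀ x ∈ F', Metric.closedBall x (1 / ((n : ℝ) + 1)) ⊆ G := by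
    rw [Filter.eventually_all_finset]
    intro x hx
    obtain ⟨ε, hε, hεG⟩ := Metric.isOpen_iff.1 hG x (Finset.mem_filter.1 hx).2
    filter_upwards [hδ.eventually_lt_const hε] with n hn
    exact (Metric.closedBall_subset_ball hn).trans hεG
  have hlim : Tendsto (fun n : ℕ => (μ : Measure X) G -
      F'.card * ENNReal.ofReal (1 / ((n : ℝ) + 1))) atTop (𝓝 ((μ : Measure X) G)) := by
    have h₁ := ENNReal.Tendsto.const_mul (a := (F'.card : ENNReal)) (ENNReal.tendsto_ofReal hδ)
      (Or.inr (ENNReal.natCast_ne_top _))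
    have h₂ := ENNReal.Tendsto.sub (tendsto_const_nhds (x := (μ : Measure X) G) (f := atTop)) h₁
      (Or.inl (measure_ne_top _ _))
    simpa using h₂
  rw [← hlim.liminf_eq]
  refine liminf_le_liminf ?_
  filter_upwards [hball] with n hn
  rw [tsub_le_iff_right, measure_eq_sum_of_compl_eq_zero hF G]
  calc ∑ x ∈ F', (μ : Measure X) {x}
      ≤ ∑ x ∈ F', (ρ n x G + ENNReal.ofReal (1 / ((n : ℝ) + 1))) := by
        refine Finset.sum_le_sum fun x hx => (hν n x (Finset.mem_filter.1 hx).1).trans ?_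
        gcongr
        exact hn x hx
    _ = ∑ x ∈ F', ρ n x G + F'.card * ENNReal.ofReal (1 / ((n : ℝ) + 1)) := by
        simp [Finset.sum_add_distrib]
    _ ≤ _ := by
        gcongr
        calc ∑ x ∈ F', ρ n x G ≤ ∑ x ∈ F, ρ n x G :=
              Finset.sum_le_sum_of_subset (Finset.filter_subset _ _)
          _ = (∑ x ∈ F, ρ n x) G := by simp
          _ ≤ _ := hρ n G

theorem isOpen_setOf_lt_measure [HasOuterApproxClosed X] {G : Set X} (hG : IsOpen G)
    (r : ENNReal) : IsOpen {μ : ProbabilityMeasure X | r < (μ : Measure X) G} := by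
  rw [isOpen_iff_mem_nhds]
  intro μ hμ
  exact eventually_lt_of_lt_liminf
    (lt_of_lt_of_le hμ (ProbabilityMeasure.le_liminf_measure_open_of_tendsto tendsto_id hG))

end ProbabilityMeasure

/-! ### Lifting measures through sections. -/

section Lift

variable {X : Type v} {Y : Type w} [MeasurableSpace X] [MeasurableSpace Y] {ι : Type*}

theorem MeasureTheory.Measure.map_sum_map_withDensity_add {φ : X → Y} (hφ : Measurable φ)
    (ν : Measure Y) {F : Finset ι} {g : ι → Y → ENNReal} (hg : ∀ i, Measurable (g i))
    (hg₁ : ∀ y, ∑ i ∈ F, g i y ≤ 1) {s : ι → Y → X} (hs : ∀ i, Measurable (s i))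
    (hsφ : ∀ i, Function.RightInverse (s i) φ) {s₀ : Y → X} (hs₀ : Measurable s₀)
    (hs₀φ : Function.RightInverse s₀ φ) :
    (∑ i ∈ F, (ν.withDensity (g i)).map (s i) +
      (ν.withDensity fun y => 1 - ∑ i ∈ F, g i y).map s₀).map φ = ν := by
  have hpre : ∀ {t : Y → X}, Function.RightInverse t φ → ∀ B : Set Y, t ⁻¹' (φ ⁻¹' B) = B :=
    fun ht B => by ext y; simp [ht y]
  have hgF : Measurable fun y => ∑ i ∈ F, g i y := Finset.measurable_sum F fun i _ => hg i
  refine Measure.ext fun B hB => ?_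
  rw [Measure.map_apply hφ hB, Measure.add_apply, Measure.finsetSum_apply,
    Measure.map_apply hs₀ (hφ hB), hpre hs₀φ, withDensity_apply _ hB]
  have : ∀ i ∈ F, (ν.withDensity (g i)).map (s i) (φ ⁻¹' B) = ∫⁻ y in B, g i y ∂ν := fun i _ => by
    rw [Measure.map_apply (hs i) (hφ hB), hpre (hsφ i), withDensity_apply _ hB]
  rw [Finset.sum_congr rfl this, ← lintegral_finsetSum _ fun i _ => hg i, ← lintegral_add_left hgF]
  simp [add_tsub_cancel_of_le (hg₁ _)]

end Lift

section ProbabilityMeasureMap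

variable {X : Type v} {Y : Type w} [TopologicalSpace X] [CompactSpace X] [MetrizableSpace X]
  [MeasurableSpace X] [BorelSpace X] [TopologicalSpace Y] [MetrizableSpace Y]
  [MeasurableSpace Y] [BorelSpace Y]

theorem MeasureTheory.ProbabilityMeasure.map_surjective_of_continuous {φ : X → Y}
    (hφ : Continuous φ) (hs : Function.Surjective φ) :
    Function.Surjective fun μ : ProbabilityMeasure X => μ.map hφ.measurable.aemeasurable := by
  intro ν
  obtain ⟨y⟩ : Nonempty Y := nonempty_of_isProbabilityMeasure (ν : Measure Y)
  have : Nonempty X := ⟨(hs y).choose⟩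
  obtain ⟨s, hsm, hsφ, -⟩ := exists_measurable_rightInverse_mapsTo hφ hs (isClosed_univ (X := X))
  refine ⟨ν.map hsm.aemeasurable, Subtype.ext ?_⟩
  change Measure.map φ (Measure.map s (ν : Measure Y)) = ν
  rw [Measure.map_map hφ.measurable hsm, hsφ.comp_eq_id, Measure.map_id]

theorem IsSemiOpen.map_probabilityMeasure {φ : X → Y} (hφ : Continuous φ)
    (hs : Function.Surjective φ) (hso : IsSemiOpen φ) :
    IsSemiOpen fun μ : ProbabilityMeasure X => μ.map hφ.measurable.aemeasurable := by
  classical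
  rintro U hU ⟨μ₀, hμ₀⟩
  let _ := metrizableSpaceMetric X
  obtain ⟨x₀⟩ : Nonempty X := nonempty_of_isProbabilityMeasure (μ₀ : Measure X)
  have : Nonempty X := ⟨x₀⟩
  have : Nonempty Y := ⟨φ x₀⟩
  obtain ⟨μ, hμU, F, hF, hF0⟩ := exists_finset_measure_compl_eq_zero_mem μ₀ (hU.mem_nhds hμ₀)
  obtain ⟨δ, hδ, hclose⟩ := exists_forall_mem_of_measure_le_closedBall hF (hU.mem_nhds hμU)
  choose y hy using fun x : X => hso (Metric.ball x δ) Metric.isOpen_ball ⟨x, by simpa⟩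
  -- Several atoms may share one value of `y`, so only distinct values are separated.
  obtain ⟨D, hD, hdisj⟩ := (F.image y).finite_toSet.t2_separation
  choose s hsm hsφ hsK using fun x : X =>
    exists_measurable_rightInverse_mapsTo hφ hs (Metric.isClosed_closedBall (x := x) (ε := δ))
  let O : X → Set Y := fun x => interior (φ '' Metric.ball x δ) ∩ D (y x)
  have hO : ∀ x, IsOpen (O x) := fun x => isOpen_interior.inter (hD _).2
  have hyO : ∀ x, y x ∈ O x := fun x => ⟨hy x, (hD _).1⟩
  have hsO : ∀ x, O x ⊆ s x ⁻¹' Metric.closedBall x δ := fun x z hz =>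
    hsK x (Set.image_mono Metric.ball_subset_closedBall (interior_subset hz.1))
  let a : X → ENNReal := fun x => (μ : Measure X) {x}
  let b : Y → ENNReal := fun z => ∑ x ∈ F with y x = z, a x
  have hsum : ∑ x ∈ F, a x = 1 := by
    have h := measure_eq_sum_of_compl_eq_zero hF Set.univ
    rw [measure_univ] at h
    simp only [Set.mem_univ, Finset.filter_true] at h
    exact h.symm
  have hab : ∀ x ∈ F, a x ≤ b (y x) := fun x hx =>
    Finset.single_le_sum (f := a) (fun _ _ => zero_le) (by simp [hx])
  have hb0 : ∀ x ∈ F, b (y x) ≠ 0 := fun x hx h => hF0 x hx (by simpa [h] using hab x hx)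
  have hb1 : ∀ z, b z ≤ 1 := fun z =>
    hsum ▸ Finset.sum_le_sum_of_subset (Finset.filter_subset _ _)
  have hbt : ∀ z, b z ≠ ⊤ := fun z => ((hb1 z).trans_lt ENNReal.one_lt_top).ne
  -- The share of the atom `x` in the total mass `b (y x)` sent to the same point.
  let c : X → ENNReal := fun x => a x / b (y x)
  have hc1 : ∀ x ∈ F, c x ≤ 1 := fun x hx => ENNReal.div_le_of_le_mul (by simpa using hab x hx)
  have hcb : ∀ x ∈ F, c x * b (y x) = a x := fun x hx =>
    ENNReal.div_mul_cancel (hb0 x hx) (hbt _)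
  let ν₀ : ProbabilityMeasure Y := ⟨∑ x ∈ F, a x • Measure.dirac (y x), ⟨by simp [hsum]⟩⟩
  have hν₀ : ∀ x, b (y x) ≤ (ν₀ : Measure Y) (O x) := by
    intro x
    have hle : b (y x) ≤ (ν₀ : Measure Y) {y x} := by
      change _ ≤ (∑ z ∈ F, a z • Measure.dirac (y z) : Measure Y) {y x}
      simp only [Measure.finsetSum_apply, Measure.smul_apply, smul_eq_mul,
        Measure.dirac_apply' _ (measurableSet_singleton _), b, Finset.sum_filter]
      refine Finset.sum_le_sum fun z _ => ?_
      split_ifs with h <;> simp [h]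
    exact hle.trans (measure_mono (by simpa using hyO x))
  let 𝒱 : Set (ProbabilityMeasure Y) :=
    ⋂ x ∈ F, {ν | b (y x) - ENNReal.ofReal δ < (ν : Measure Y) (O x)}
  have h𝒱 : IsOpen 𝒱 := isOpen_biInter_finset fun x _ => isOpen_setOf_lt_measure (hO x) _
  refine ⟨ν₀, mem_interior.2 ⟨𝒱, fun ν hν => ?_, h𝒱, Set.mem_iInter₂.2 fun x hx =>
    (ENNReal.sub_lt_self (hbt _) (hb0 x hx) (by simpa using hδ)).trans_le (hν₀ x)⟩⟩
  rw [Set.mem_iInter₂] at hν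
  let g : X → Y → ENNReal := fun x => (O x).indicator fun _ => c x
  have hg : ∀ x, Measurable (g x) := fun x => measurable_const.indicator (hO x).measurableSet
  have hg₁ : ∀ z, ∑ x ∈ F, g x z ≤ 1 := by
    intro z
    -- All atoms contributing at `z` have the same `y`-value, so their shares add up to at most `1`.
    by_cases h : ∃ x ∈ F, z ∈ O x
    · obtain ⟨x, hx, hz⟩ := h
      have huniq : ∀ w ∈ F, z ∈ O w → y w = y x := by
        intro w hw hzw
        by_contra hne
        exact Set.disjoint_left.1 (hdisj (by simpa using ⟨w, hw, rfl⟩)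
          (by simpa using ⟨x, hx, rfl⟩) hne) hzw.2 hz.2
      calc ∑ w ∈ F, g w z ≤ ∑ w ∈ F, if y w = y x then a w / b (y x) else 0 := by
            refine Finset.sum_le_sum fun w hw => ?_
            by_cases hzw : z ∈ O w
            · simp [g, hzw, huniq w hw hzw, c]
            · simp [g, hzw]
        _ = b (y x) / b (y x) := by
            rw [← Finset.sum_filter]
            simp only [b, div_eq_mul_inv, Finset.sum_mul]
        _ ≤ 1 := ENNReal.div_self_le_one
    · push Not at h
      rw [Finset.sum_eq_zero fun x hx => Set.indicator_of_notMem (h x hx) _]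
      exact zero_le
  let ρ : X → Measure X := fun x => ((ν : Measure Y).withDensity (g x)).map (s x)
  let m : Measure X := ∑ x ∈ F, ρ x +
    ((ν : Measure Y).withDensity fun z => 1 - ∑ x ∈ F, g x z).map (s x₀)
  have hm : m.map φ = ν := Measure.map_sum_map_withDensity_add hφ.measurable _ hg hg₁ hsm hsφ
    (hsm x₀) (hsφ x₀)
  have hmp : IsProbabilityMeasure m := ⟨by
    have := congrArg (fun ν : Measure Y => ν Set.univ) hm
    simpa [Measure.map_apply hφ.measurable MeasurableSet.univ] using this⟩
  refine ⟨⟨m, hmp⟩, hclose _ ρ (Measure.le_add_right le_rfl) fun x hx => ?_, Subtype.ext hm⟩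
  calc a x = c x * b (y x) := (hcb x hx).symm
    _ ≤ c x * ((ν : Measure Y) (O x) + ENNReal.ofReal δ) := by
        gcongr
        exact tsub_le_iff_right.1 (hν x hx).le
    _ ≤ c x * (ν : Measure Y) (O x) + ENNReal.ofReal δ := by
        rw [mul_add]
        gcongr
        exact mul_le_of_le_one_left (zero_le) (hc1 x hx)
    _ = (ν : Measure Y).withDensity (g x) (O x) + ENNReal.ofReal δ := by
        rw [withDensity_apply _ (hO x).measurableSet, lintegral_indicator (hO x).measurableSet]
        simp
    _ ≤ _ := by
        gcongr
        change _ ≤ Measure.map (s x) _ _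
        rw [Measure.map_apply (hsm x) Metric.isClosed_closedBall.measurableSet]
        exact measure_mono (hsO x)

end ProbabilityMeasureMap

/-! ### Flows on spaces of measures. -/

/-- By compactness of `X`, `t ↦ f (t • ·)` is continuous in the sup norm, so changing `t` alters
integrals uniformly over all probability measures; what remains is weak continuity at fixed `t₀`. -/
theorem MeasureTheory.ProbabilityMeasure.continuous_map_smul {T : Type u} {X : Type v}
    [TopologicalSpace T] [TopologicalSpace X] [CompactSpace X] [MeasurableSpace X] [BorelSpace X]
    [SMul T X] [ContinuousSMul T X] :
    Continuous fun p : T × ProbabilityMeasure X =>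
      p.2.map (continuous_const_smul p.1).measurable.aemeasurable := by
  rw [continuous_iff_continuousAt]
  rintro ⟨t₀, μ₀⟩
  refine ProbabilityMeasure.tendsto_iff_forall_integral_tendsto.2 fun f => ?_
  let F : C(T, C(X, ℝ)) := ContinuousMap.curry ⟨fun p : T × X => f (p.1 • p.2), by fun_prop⟩
  have hint : ∀ p : T × ProbabilityMeasure X,
      ∫ x, f x ∂(p.2.map (continuous_const_smul p.1).measurable.aemeasurable : Measure X) =
        ∫ x, F p.1 x ∂(p.2 : Measure X) := fun p =>
    integral_map (continuous_const_smul p.1).measurable.aemeasurable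
      f.continuous.measurable.aestronglyMeasurable
  have hin : ∀ (g : C(X, ℝ)) (μ : ProbabilityMeasure X), Integrable g (μ : Measure X) :=
    fun g μ => (BoundedContinuousFunction.mkOfCompact g).integrable _
  simp only [hint]
  rw [hint (t₀, μ₀)]
  have h₁ : Filter.Tendsto (fun p : T × ProbabilityMeasure X => ∫ x, F t₀ x ∂(p.2 : Measure X))
      (𝓝 (t₀, μ₀)) (𝓝 (∫ x, F t₀ x ∂(μ₀ : Measure X))) :=
    ((ProbabilityMeasure.continuous_integral_boundedContinuousFunction
      (BoundedContinuousFunction.mkOfCompact (F t₀))).comp continuous_snd).tendsto _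
  refine h₁.congr_dist (squeeze_zero (fun _ => dist_nonneg)
    (g := fun p : T × ProbabilityMeasure X => ‖F t₀ - F p.1‖) (fun p => ?_) ?_)
  · rw [dist_eq_norm, ← integral_sub (hin _ _) (hin _ _)]
    simpa using norm_integral_le_of_norm_le_const (μ := (p.2 : Measure X))
      (.of_forall fun x => (F t₀ - F p.1).norm_coe_le_norm x)
  · have : Continuous fun p : T × ProbabilityMeasure X => ‖F t₀ - F p.1‖ := by fun_prop
    simpa using this.tendsto (t₀, μ₀)

theorem ProbSpace.metrizableSpace (X : Type v) [TopologicalSpace X] [CompactSpace X]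
    [MetrizableSpace X] : MetrizableSpace (ProbSpace X) := by
  let _ : MeasurableSpace X := borel X
  have : BorelSpace X := ⟨rfl⟩
  let _ := metrizableSpaceMetric X
  exact inferInstanceAs (MetrizableSpace (ProbabilityMeasure X))

theorem IsCompactFlow.probSpace {T : Type u} {X : Type v} [TopologicalSpace T] [Group T]
    [TopologicalSpace X] [MulAction T X] [ContinuousConstSMul T X] [MetrizableSpace X]
    (h : IsCompactFlow T X) : IsCompactFlow T (ProbSpace X) := by
  obtain ⟨_, _, _⟩ := h
  let _ : MeasurableSpace X := borel X
  have : BorelSpace X := ⟨rfl⟩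
  have := ProbSpace.metrizableSpace X
  exact ⟨inferInstanceAs (CompactSpace (ProbabilityMeasure X)), inferInstance,
    ⟨ProbabilityMeasure.continuous_map_smul (T := T) (X := X)⟩⟩

theorem IsSemiOpenFlowExtension.probMap {T : Type u} {X : Type v} {Y : Type w}
    [TopologicalSpace T] [Group T] [TopologicalSpace X] [MulAction T X] [ContinuousConstSMul T X]
    [TopologicalSpace Y] [MulAction T Y] [ContinuousConstSMul T Y] [MetrizableSpace X]
    [MetrizableSpace Y] {φ : C(X, Y)}
    (h : IsSemiOpenFlowExtension T φ) : IsSemiOpenFlowExtension T (probMap φ) := by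
  have := h.isFlowExtension.source.compactSpace
  let _ : MeasurableSpace X := borel X
  have : BorelSpace X := ⟨rfl⟩
  let _ : MeasurableSpace Y := borel Y
  have : BorelSpace Y := ⟨rfl⟩
  refine ⟨⟨h.isFlowExtension.source.probSpace, h.isFlowExtension.target.probSpace,
    ProbabilityMeasure.map_surjective_of_continuous φ.continuous h.isFlowExtension.surjective,
    fun t μ => ?_⟩, IsSemiOpen.map_probabilityMeasure φ.continuous h.isFlowExtension.surjective
      h.isSemiOpen⟩
  apply Subtype.ext
  change Measure.map φ (Measure.map (fun x : X => t • x) μ.1) =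
    Measure.map (fun y : Y => t • y) (Measure.map φ μ.1)
  rw [Measure.map_map φ.continuous.measurable (continuous_const_smul t).measurable,
    Measure.map_map (continuous_const_smul t).measurable φ.continuous.measurable]
  congr 1
  exact funext fun x => h.isFlowExtension.map_smul t x

theorem corollary7 {T : Type u} {X : Type v} {Y : Type w}
    [TopologicalSpace T] [Group T] [IsTopologicalGroup T]
    [TopologicalSpace X] [CompactSpace X] [T2Space X]
    [MulAction T X] [ContinuousSMul T X] [MulAction.IsMinimal T X]
    [TopologicalSpace Y] [CompactSpace Y] [T2Space Y]
    [MulAction T Y] [ContinuousSMul T Y] [MulAction.IsMinimal T Y]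
    (φ : C(X, Y)) (hφ : IsFlowExtension T φ) :
    (IsSemiOpenFlowExtension T (hyperMap φ) ∧
      IsSemiOpenFlowExtension T (hyperMap (hyperMap φ))) ∧
    (MetrizableSpace X → MetrizableSpace Y →
      IsSemiOpenFlowExtension T (probMap φ) ∧
      IsSemiOpenFlowExtension T (probMap (probMap φ))) := by
  have h : IsSemiOpenFlowExtension T φ := ⟨hφ, hφ.isSemiOpen⟩
  refine ⟨⟨h.hyperMap, h.hyperMap.hyperMap⟩, fun _ _ => ?_⟩
  -- Metrizability of the measure spaces is what allows `probMap` to be applied a second time.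
  have := ProbSpace.metrizableSpace X
  have := ProbSpace.metrizableSpace Y
  exact ⟨h.probMap, h.probMap.probMap⟩
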